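/- Let $k$ be a field. An augmented $k$-algebra is a unital associative $k$-algebra $A$ with a $k$-algebra homomorphism $\varepsilon_A : A \to k$; morphisms are $k$-algebra homomorphisms commuting with the augmentations. The product $A * B$ of augmented $k$-algebras is the fibre product $\{(a,b)\in A\times B : \varepsilon_A(a)=\varepsilon_B(b)\}$, augmented by $(a,b)\mapsto \varepsilon_A(a)$; the coproduct $A\sqcup B$ is the free product of $k$-algebras, with the augmentation that restricts to $\varepsilon_A$ and $\varepsilon_B$; write $i_A : A\to A\sqcup B$ and $i_B : B\to A\sqcup B$ for the canonical injections. Regard $k$ as an $A$-module through $\varepsilon_A$ and let $E(A)=\operatorname{Ext}^*_A(k,k)=\bigoplus_{n\ge 0}\operatorname{Ext}^n_A(k,k)$ with the Yoneda product, an augmented $k$-algebra by the map $E(A)\to \operatorname{Ext}^0_A(k,k)=k$ killing all elements of positive degree. A morphism $f:A\to B$ induces a morphism of augmented $k$-algebras $E(f):E(B)\to E(A)$ by restricting exact sequences of $B$-modules to $A$ along $f$. **Theorem 4.1.** Let $\Lambda$ and $\Gamma$ be augmented $k$-algebras. Then the morphism $$E(i_\Lambda)*E(i_\Gamma) : \operatorname{Ext}^*_{\Lambda\sqcup\Gamma}(k,k)\longrightarrow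 \operatorname{Ext}^*_\Lambda(k,k) * \operatorname{Ext}^*_\Gamma(k,k),\qquad x\mapsto \bigl(E(i_\Lambda)(x),\,E(i_\Gamma)(x)\bigr),$$ is an isomorphism of augmented $k$-algebras. -/

import Mathlib

open CategoryTheory CategoryTheory.Abelian
open scoped DirectSum

universe u

/-- An augmented `k`-algebra: a unital associative `k`-algebra together with a `k`-algebra
homomorphism to `k`. -/
structure AugAlg (k : Type u) [Field k] where
  /-- the underlying type -/
  carrier : Type u
  [ring : Ring carrier]
  [algebra : Algebra k carrier]
  /-- the augmentation -/
  aug : carrier →ₐ[k] k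

namespace AugAlg

attribute [instance] AugAlg.ring AugAlg.algebra

variable {k : Type u} [Field k]

instance : CoeSort (AugAlg k) (Type u) := ⟨AugAlg.carrier⟩

/-- Morphisms of augmented algebras: algebra homomorphisms preserving the augmentations. -/
structure Hom (A B : AugAlg k) where
  /-- the underlying algebra homomorphism -/
  toAlgHom : A →ₐ[k] B
  aug_comp : B.aug.comp toAlgHom = A.aug

/-! ### The product (fibre product over `k`) -/

/-- The underlying algebra `{(a, b) | ε a = ε b}` of the product of `A` and `B`. -/
def prodSubalgebra (A B : AugAlg k) : Subalgebra k (A × B) :=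
  AlgHom.equalizer (A.aug.comp (AlgHom.fst k A B)) (B.aug.comp (AlgHom.snd k A B))

/-- The product `A * B` of augmented algebras: the pullback of the two augmentations. -/
def prod (A B : AugAlg k) : AugAlg k where
  carrier := prodSubalgebra A B
  aug := (A.aug.comp (AlgHom.fst k A B)).comp (prodSubalgebra A B).val

/-- The morphism `f * g : C ⟶ A * B`, `c ↦ (f c, g c)`, given by the universal property of the
product. -/
def prodLift {A B C : AugAlg k} (f : Hom C A) (g : Hom C B) : Hom C (prod A B) where
  toAlgHom := (f.toAlgHom.prod g.toAlgHom).codRestrict (prodSubalgebra A B) (fun c =>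
    (DFunLike.congr_fun f.aug_comp c).trans (DFunLike.congr_fun g.aug_comp c).symm)
  aug_comp := AlgHom.ext fun c => DFunLike.congr_fun f.aug_comp c

/-! ### The coproduct (free product) -/

/-- Two augmented algebras as a family indexed by `Bool`. -/
def pair (A B : AugAlg k) : Bool → AugAlg k
  | false => A
  | true => B

/-- The coproduct `A ⊔ B` of augmented algebras: the free product of the two `k`-algebras, with the
augmentation that restricts to the given ones on the factors. -/
noncomputable def coprod (A B : AugAlg k) : AugAlg k where
  carrier := LinearAlgebra.FreeProduct k (fun i => (pair A B i : Type u))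
  aug := LinearAlgebra.FreeProduct.lift k (fun i => (pair A B i : Type u))
    (fun {i} => (pair A B i).aug)

/-- The canonical injection `A ⟶ A ⊔ B`. -/
noncomputable def coprodInl (A B : AugAlg k) : Hom A (coprod A B) where
  toAlgHom := LinearAlgebra.FreeProduct.ι k (fun i => (pair A B i : Type u)) false
  aug_comp := LinearAlgebra.FreeProduct.lift_comp_ι (i := false) k
    (fun i => (pair A B i : Type u)) (fun {i} => (pair A B i).aug)

/-- The canonical injection `B ⟶ A ⊔ B`. -/
noncomputable def coprodInr (A B : AugAlg k) : Hom B (coprod A B) where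
  toAlgHom := LinearAlgebra.FreeProduct.ι k (fun i => (pair A B i : Type u)) true
  aug_comp := LinearAlgebra.FreeProduct.lift_comp_ι (i := true) k
    (fun i => (pair A B i : Type u)) (fun {i} => (pair A B i).aug)

/-! ### The Ext-algebra -/

/-- The trivial left `A`-module `k`: `A` acts through its augmentation. -/
noncomputable def triv (A : AugAlg k) : ModuleCat.{u} A :=
  (ModuleCat.restrictScalars A.aug.toRingHom).obj (ModuleCat.of k k)

/-- `Ext ^ n _ A (k, k)`. -/
abbrev ExtDeg (A : AugAlg k) (n : ℕ) : Type u := Ext.{u} (triv A) (triv A) n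

lemma mk_comp_eq {C : Type*} [Category C] [Abelian C] [HasExt C] {X : C} {a b c d : ℕ}
    (α : Ext X X a) (β : Ext X X b) (h : a + b = c) (h' : a + b = d) :
    GradedMonoid.mk (A := fun n => Ext X X n) c (α.comp β h) = GradedMonoid.mk d (α.comp β h') := by
  subst h; subst h'; rfl

noncomputable instance (A : AugAlg k) : GradedMonoid.GOne (ExtDeg A) where
  one := Ext.mk₀ (𝟙 (triv A))

/-- The Yoneda product on `Ext ^ * _ A (k, k)`; `x * y` is the composite "`y`, then `x`". -/
noncomputable instance (A : AugAlg k) : GradedMonoid.GMul (ExtDeg A) where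
  mul {i j} x y := Ext.comp y x (add_comm j i)

noncomputable instance (A : AugAlg k) : DirectSum.GRing (ExtDeg A) where
  mul_zero _ := Ext.zero_comp _ _ _ _ _
  zero_mul y := Ext.comp_zero _ _ _ _ _
  mul_add _ _ _ := Ext.add_comp _ _ _ _
  add_mul _ _ _ := Ext.comp_add _ _ _ _
  one_mul := fun ⟨_, x⟩ => (mk_comp_eq _ _ _ (add_zero _)).trans
    (congrArg (GradedMonoid.mk _) (Ext.comp_mk₀_id x))
  mul_one := fun ⟨_, x⟩ => (mk_comp_eq _ _ _ (zero_add _)).trans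
    (congrArg (GradedMonoid.mk _) (Ext.mk₀_id_comp x))
  mul_assoc := fun ⟨a, x⟩ ⟨b, y⟩ ⟨c, z⟩ => by
    have h : c + (a + b) = a + (b + c) := by omega
    have h' : b + c + a = a + (b + c) := by omega
    refine (mk_comp_eq z (Ext.comp y x (add_comm b a)) _ h).trans ?_
    refine Eq.trans ?_ (mk_comp_eq (Ext.comp z y (add_comm c b)) x h' _)
    refine congrArg (GradedMonoid.mk _) ?_
    exact (Ext.comp_assoc z y x (add_comm c b) (add_comm b a) (by omega)).symm
  natCast n := n • Ext.mk₀ (𝟙 (triv A))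
  natCast_zero := zero_smul _ _
  natCast_succ n := succ_nsmul _ n
  intCast n := n • Ext.mk₀ (𝟙 (triv A))
  intCast_ofNat n := natCast_zsmul _ n
  intCast_negSucc_ofNat n := negSucc_zsmul _ n

/-- The `k`-algebra structure on `Ext ^ * _ A (k, k)`: it induces the usual `k`-vector space
structure on each `Ext ^ n _ A (k, k)`. -/
noncomputable instance (A : AugAlg k) : DirectSum.GAlgebra k (ExtDeg A) where
  toFun := (LinearMap.toSpanSingleton k (ExtDeg A 0) (Ext.mk₀ (𝟙 (triv A)))).toAddMonoidHom
  map_one := one_smul k (Ext.mk₀ (𝟙 (triv A)) : ExtDeg A 0)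
  map_mul r s := by
    refine Eq.trans ?_ (mk_comp_eq _ _ (zero_add 0) _)
    refine congrArg (GradedMonoid.mk _) ?_
    change (r * s) • Ext.mk₀ (𝟙 (triv A)) =
      Ext.comp (s • Ext.mk₀ (𝟙 (triv A))) (r • Ext.mk₀ (𝟙 (triv A))) _
    rw [Ext.comp_smul, Ext.smul_comp, Ext.mk₀_id_comp, mul_smul]
  commutes := fun r ⟨n, x⟩ => by
    refine (mk_comp_eq x (r • Ext.mk₀ (𝟙 (triv A))) _ (add_zero n)).trans
      (Eq.trans ?_ (mk_comp_eq (r • Ext.mk₀ (𝟙 (triv A))) x (zero_add n) _))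
    rw [Ext.comp_smul, Ext.smul_comp, Ext.mk₀_id_comp, Ext.comp_mk₀_id]
  smul_def := fun r ⟨n, x⟩ => by
    refine Eq.trans ?_ (mk_comp_eq x (r • Ext.mk₀ (𝟙 (triv A))) (add_zero n) _)
    rw [Ext.comp_smul, Ext.comp_mk₀_id]
    rfl

/-- Evaluation at `1` of the `A`-linear endomorphisms of `k`. -/
noncomputable def evalOne (A : AugAlg k) : (triv A ⟶ triv A) →ₗ[k] k where
  toFun φ := show k from φ.hom (1 : k)
  map_add' _ _ := rfl
  map_smul' r φ := by
    change A.aug (algebraMap k A r) * (show k from φ.hom (1 : k)) = r * (show k from φ.hom (1 : k))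
    rw [AlgHom.commutes]; rfl

lemma evalOne_comp (A : AugAlg k) (φ ψ : triv A ⟶ triv A) :
    evalOne A (φ ≫ ψ) = evalOne A ψ * evalOne A φ := by
  have h1 : ∀ a b : k, A.aug (algebraMap k A a) * b = a * b := by
    intro a b
    rw [AlgHom.commutes]; rfl
  have h2 : (show k from ψ.hom (A.aug (algebraMap k A (evalOne A φ)) * (1 : k) : k)) =
      A.aug (algebraMap k A (evalOne A φ)) * evalOne A ψ :=
    ψ.hom.map_smul (algebraMap k A (evalOne A φ)) (1 : k)
  rw [h1, h1, mul_one] at h2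
  exact h2.trans (mul_comm (evalOne A φ) (evalOne A ψ))

/-- The components of the augmentation of the Ext-algebra: `Ext ^ 0 _ A (k, k) = Hom _ A (k, k) = k`
in degree `0`, and zero in positive degrees. -/
noncomputable def extAugDeg (A : AugAlg k) : (n : ℕ) → ExtDeg A n →ₗ[k] k
  | 0 => (evalOne A).comp (Ext.linearEquiv₀ (R := k)).toLinearMap
  | _ + 1 => 0

lemma extAugDeg_one (A : AugAlg k) : extAugDeg A 0 (Ext.mk₀ (𝟙 (triv A))) = 1 := by
  have h : Ext.linearEquiv₀ (R := k) (Ext.mk₀ (𝟙 (triv A))) = 𝟙 (triv A) :=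
    (Ext.mk₀_bijective _ _).1 (Ext.mk₀_linearEquiv₀_apply _)
  change evalOne A (Ext.linearEquiv₀ (R := k) (Ext.mk₀ (𝟙 (triv A)))) = 1
  rw [h]; rfl

lemma extAugDeg_mul (A : AugAlg k) {i j : ℕ} (x : ExtDeg A i) (y : ExtDeg A j) :
    extAugDeg A (i + j) (GradedMonoid.GMul.mul x y) = extAugDeg A i x * extAugDeg A j y := by
  cases i with
  | succ i =>
    cases j with
    | zero => exact (zero_mul _).symm
    | succ j => exact (zero_mul _).symm
  | zero =>
    cases j with
    | succ j => exact (mul_zero _).symm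
    | zero =>
      obtain ⟨φ, rfl⟩ := (Ext.mk₀_bijective _ _).2 x
      obtain ⟨ψ, rfl⟩ := (Ext.mk₀_bijective _ _).2 y
      have h : ∀ χ : triv A ⟶ triv A, extAugDeg A 0 (Ext.mk₀ χ) = evalOne A χ := fun χ =>
        congrArg (evalOne A) ((Ext.mk₀_bijective _ _).1 (Ext.mk₀_linearEquiv₀_apply (R := k) _))
      have h2 : (GradedMonoid.GMul.mul (A := ExtDeg A) (i := 0) (j := 0)
          (Ext.mk₀ φ) (Ext.mk₀ ψ)) = Ext.mk₀ (ψ ≫ φ) := Ext.mk₀_comp_mk₀ ψ φ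
      rw [h2, h φ, h ψ]
      exact (h _).trans (evalOne_comp A ψ φ)

/-- The augmentation of the Ext-algebra, killing all elements of positive degree. -/
noncomputable def extAug (A : AugAlg k) : (⨁ n, ExtDeg A n) →ₐ[k] k :=
  DirectSum.toAlgebra k (ExtDeg A) (extAugDeg A) (extAugDeg_one A) (extAugDeg_mul A)

lemma extAug_of (A : AugAlg k) (n : ℕ) (x : ExtDeg A n) :
    extAug A (DirectSum.of (ExtDeg A) n x) = extAugDeg A n x :=
  DirectSum.toModule_lof k n x

/-- The Ext-algebra `E A = Ext ^ * _ A (k, k)`, with the Yoneda product, augmented by the map killing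
all elements of positive degree. -/
noncomputable def E (A : AugAlg k) : AugAlg k where
  carrier := ⨁ n, ExtDeg A n
  aug := extAug A

/-! ### Functoriality of the Ext-algebra -/

lemma restrictScalars_exact {R S : Type u} [Ring R] [Ring S] (f : R →+* S)
    (T : ShortComplex (ModuleCat.{u} S)) (h : T.Exact) :
    (T.map (ModuleCat.restrictScalars.{u} f)).Exact := by
  rw [ShortComplex.ShortExact.moduleCat_exact_iff_function_exact] at h ⊢
  exact h

instance {R S : Type u} [Ring R] [Ring S] (f : R →+* S) :
    Limits.PreservesFiniteLimits (ModuleCat.restrictScalars.{u} f) := by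
  have := ((Functor.exact_tfae (ModuleCat.restrictScalars.{u} f)).out 1 3).mp
    (restrictScalars_exact f)
  exact this.1

instance {R S : Type u} [Ring R] [Ring S] (f : R →+* S) :
    Limits.PreservesFiniteColimits (ModuleCat.restrictScalars.{u} f) := by
  have := ((Functor.exact_tfae (ModuleCat.restrictScalars.{u} f)).out 1 3).mp
    (restrictScalars_exact f)
  exact this.2

/-- The identity of `k`, as an isomorphism from the trivial `A`-module to the restriction along
`f : A ⟶ B` of the trivial `B`-module. -/
noncomputable def trivIso {A B : AugAlg k} (f : Hom A B) :
    triv A ≅ (ModuleCat.restrictScalars f.toAlgHom.toRingHom).obj (triv B) :=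
  ModuleCat.restrictScalarsComp'App f.toAlgHom.toRingHom B.aug.toRingHom A.aug.toRingHom
    (congrArg AlgHom.toRingHom f.aug_comp.symm) (ModuleCat.of k k)

/-- The map `Ext ^ n _ B (k, k) → Ext ^ n _ A (k, k)` given by restricting (exact sequences of)
`B`-modules to `A`-modules along `f : A ⟶ B`. -/
noncomputable def extMapDeg {A B : AugAlg k} (f : Hom A B) (n : ℕ) : ExtDeg B n →ₗ[k] ExtDeg A n where
  toFun x := (Ext.mk₀ (trivIso f).hom).comp
    ((x.mapExactFunctor (ModuleCat.restrictScalars f.toAlgHom.toRingHom)).comp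
      (Ext.mk₀ (trivIso f).inv) (add_zero n)) (zero_add n)
  map_add' x y := by
    rw [Ext.mapExactFunctor_add, Ext.add_comp, Ext.comp_add]
  map_smul' r x := by
    rw [Functor.mapExactFunctor_smul, Ext.smul_comp, Ext.comp_smul]; rfl

lemma extMapDeg_mk₀ {A B : AugAlg k} (f : Hom A B) (φ : triv B ⟶ triv B) :
    extMapDeg f 0 (Ext.mk₀ φ) = Ext.mk₀ ((trivIso f).hom ≫
      (ModuleCat.restrictScalars f.toAlgHom.toRingHom).map φ ≫ (trivIso f).inv) := by
  change (Ext.mk₀ (trivIso f).hom).comp (((Ext.mk₀ φ).mapExactFunctor _).comp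
      (Ext.mk₀ (trivIso f).inv) (add_zero 0)) (zero_add 0) = _
  rw [Ext.mapExactFunctor_mk₀, Ext.mk₀_comp_mk₀, Ext.mk₀_comp_mk₀]

lemma extMapDeg_one {A B : AugAlg k} (f : Hom A B) :
    extMapDeg f 0 (Ext.mk₀ (𝟙 (triv B))) = Ext.mk₀ (𝟙 (triv A)) := by
  rw [extMapDeg_mk₀, CategoryTheory.Functor.map_id, Category.id_comp, Iso.hom_inv_id]

lemma comp_conj {C : Type*} [Category C] [Abelian C] [HasExt C] {X Y : C} (e : X ≅ Y)
    {i j n : ℕ} (y : Ext Y Y j) (x : Ext Y Y i) (h : j + i = n) :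
    (Ext.mk₀ e.hom).comp ((y.comp x h).comp (Ext.mk₀ e.inv) (add_zero n)) (zero_add n) =
      ((Ext.mk₀ e.hom).comp (y.comp (Ext.mk₀ e.inv) (add_zero j)) (zero_add j)).comp
        ((Ext.mk₀ e.hom).comp (x.comp (Ext.mk₀ e.inv) (add_zero i)) (zero_add i)) h := by
  subst h
  rw [Ext.comp_assoc (Ext.mk₀ e.hom) _ _ (zero_add j) rfl (by omega),
    Ext.comp_assoc_of_second_deg_zero y (Ext.mk₀ e.inv) _ rfl,
    ← Ext.comp_assoc (Ext.mk₀ e.inv) (Ext.mk₀ e.hom) _ (zero_add 0) (zero_add i) (by omega),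
    Ext.mk₀_comp_mk₀, Iso.inv_hom_id, Ext.mk₀_id_comp,
    Ext.comp_assoc_of_third_deg_zero]

lemma extMapDeg_mul {A B : AugAlg k} (f : Hom A B) {i j : ℕ} (x : ExtDeg B i) (y : ExtDeg B j) :
    extMapDeg f (i + j) (GradedMonoid.GMul.mul x y) =
      GradedMonoid.GMul.mul (extMapDeg f i x) (extMapDeg f j y) := by
  refine Eq.trans ?_ (comp_conj (trivIso f) (y.mapExactFunctor _) (x.mapExactFunctor _)
    (add_comm j i))
  rw [← Ext.mapExactFunctor_comp]
  rfl

lemma extMapDeg_aug {A B : AugAlg k} (f : Hom A B) (n : ℕ) (x : ExtDeg B n) :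
    extAugDeg A n (extMapDeg f n x) = extAugDeg B n x := by
  cases n with
  | succ n => rfl
  | zero =>
    obtain ⟨φ, rfl⟩ := (Ext.mk₀_bijective _ _).2 x
    rw [extMapDeg_mk₀]
    have h : ∀ (C : AugAlg k) (χ : triv C ⟶ triv C),
        extAugDeg C 0 (Ext.mk₀ χ) = evalOne C χ := fun C χ =>
      congrArg (evalOne C) ((Ext.mk₀_bijective _ _).1 (Ext.mk₀_linearEquiv₀_apply (R := k) _))
    rw [h, h]
    rfl

/-- The algebra homomorphism between direct sums given by maps of the graded components. -/
noncomputable def gradedMap {V W : ℕ → Type u} [∀ n, AddCommMonoid (V n)]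
    [∀ n, AddCommMonoid (W n)] [∀ n, Module k (V n)] [∀ n, Module k (W n)]
    [DirectSum.GSemiring V] [DirectSum.GSemiring W] [DirectSum.GAlgebra k V] [DirectSum.GAlgebra k W]
    (f : ∀ n, V n →ₗ[k] W n) (hone : f 0 GradedMonoid.GOne.one = GradedMonoid.GOne.one)
    (hmul : ∀ {i j : ℕ} (x : V i) (y : V j),
      f (i + j) (GradedMonoid.GMul.mul x y) = GradedMonoid.GMul.mul (f i x) (f j y)) :
    (⨁ n, V n) →ₐ[k] (⨁ n, W n) :=
  DirectSum.toAlgebra k V (fun n => (DirectSum.lof k ℕ W n).comp (f n))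
    (congrArg (DirectSum.lof k ℕ W 0) hone)
    (fun {i j} x y => (congrArg (DirectSum.lof k ℕ W (i + j)) (hmul x y)).trans
      (DirectSum.of_mul_of (A := W) _ _).symm)

lemma gradedMap_of {V W : ℕ → Type u} [∀ n, AddCommMonoid (V n)]
    [∀ n, AddCommMonoid (W n)] [∀ n, Module k (V n)] [∀ n, Module k (W n)]
    [DirectSum.GSemiring V] [DirectSum.GSemiring W] [DirectSum.GAlgebra k V] [DirectSum.GAlgebra k W]
    (f : ∀ n, V n →ₗ[k] W n) (hone : f 0 GradedMonoid.GOne.one = GradedMonoid.GOne.one)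
    (hmul : ∀ {i j : ℕ} (x : V i) (y : V j),
      f (i + j) (GradedMonoid.GMul.mul x y) = GradedMonoid.GMul.mul (f i x) (f j y))
    (n : ℕ) (x : V n) :
    gradedMap f hone hmul (DirectSum.of V n x) = DirectSum.of W n (f n x) :=
  DirectSum.toModule_lof (φ := fun n => (DirectSum.lof k ℕ W n).comp (f n)) k n x

/-- The algebra homomorphism `Ext ^ * _ B (k, k) → Ext ^ * _ A (k, k)` induced by `f : A ⟶ B`. -/
noncomputable def extMap {A B : AugAlg k} (f : Hom A B) :
    (⨁ n, ExtDeg B n) →ₐ[k] (⨁ n, ExtDeg A n) :=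
  gradedMap (extMapDeg f) (extMapDeg_one f) (extMapDeg_mul f)

lemma extMap_of {A B : AugAlg k} (f : Hom A B) (n : ℕ) (x : ExtDeg B n) :
    extMap f (DirectSum.of (ExtDeg B) n x) = DirectSum.of (ExtDeg A) n (extMapDeg f n x) :=
  gradedMap_of _ _ _ n x

lemma extAug_comp_extMap {A B : AugAlg k} (f : Hom A B) :
    (extAug A).comp (extMap f) = extAug B := by
  refine DirectSum.algHom_ext (R := k) (A := ExtDeg B) (fun n x => ?_)
  rw [AlgHom.comp_apply, extMap_of, extAug_of, extAug_of, extMapDeg_aug]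

/-- The morphism `E f : E B ⟶ E A` induced by `f : A ⟶ B`. -/
noncomputable def E.map {A B : AugAlg k} (f : Hom A B) : Hom (E B) (E A) where
  toAlgHom := extMap f
  aug_comp := extAug_comp_extMap f

end AugAlg

/-! Let `S` be the free product of `A` and `B`. An `S`-module is a vector space with two unrelated
actions, so `Hom_S(M, N)` is the kernel of the difference map from `Hom_A(M, N) ⊕ Hom_B(M, N)` to
`Hom_k(M, N)`. For projective `M` the difference map is onto (`exists_eq_add`), and projective
`S`-modules stay projective over both factors (`projective_left`, `symm`). A projective resolution
therefore yields a Mayer–Vietoris sequence relating Ext over `S`, over the two factors and over `k`.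

Ext over the field `k` vanishes in positive degrees. So restriction from `Ext^n_S` to `Ext^n_A ×
Ext^n_B` is onto for `n ≥ 1` and bijective for `n ≥ 2`; its kernel for `n = 1` is the cokernel of
the difference map. That cokernel vanishes for `M = N = k`, where every linear map is linear over
both factors. In degree 0 all three groups are `k`, which accounts for the fibre product.

Instead of building the long exact sequence, the proof treats degree 1 by hand (`exists_hom_sub`,
`exists_extension`) and shifts dimensions. `Decomposable` says that the difference map is onto.
Restriction already respects products and augmentations, so only bijectivity in each degree is at
stake. -/

/-- The universal property of the free product, for algebras in one universe. -/
def IsFreeProduct {k A B S : Type u} [Field k] [Ring A] [Ring B] [Ring S] [Algebra k A]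
    [Algebra k B] [Algebra k S] (i : A →ₐ[k] S) (j : B →ₐ[k] S) : Prop :=
  ∀ (W : Type u) [Ring W] [Algebra k W] (f : A →ₐ[k] W) (g : B →ₐ[k] W),
    ∃! h : S →ₐ[k] W, h.comp i = f ∧ h.comp j = g

/-! ### Actions of a free product and splittings of its projective modules -/

namespace IsFreeProduct

variable {k A B S : Type u} [Field k] [Ring A] [Ring B] [Ring S] [Algebra k A]
    [Algebra k B] [Algebra k S] {i : A →ₐ[k] S} {j : B →ₐ[k] S}

/-- The free product is generated by its two factors. -/
lemma eq_top (H : IsFreeProduct i j) (T : Subalgebra k S) (hi : ∀ a, i a ∈ T)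
    (hj : ∀ b, j b ∈ T) : T = ⊤ := by
  obtain ⟨h, ⟨h1, h2⟩, -⟩ := H T (i.codRestrict T hi) (j.codRestrict T hj)
  -- By uniqueness the identity of `S` factors through `T`.
  have : T.val.comp h = AlgHom.id k S := by
    refine (H S i j).unique ⟨?_, ?_⟩ ⟨rfl, rfl⟩
    · rw [AlgHom.comp_assoc, h1]; rfl
    · rw [AlgHom.comp_assoc, h2]; rfl
  refine Algebra.eq_top_iff.2 fun s => ?_
  have := DFunLike.congr_fun this s
  change (h s : S) = s at this
  exact this ▸ (h s).2

/-- A linear map commuting with actions of the two factors commutes with the actions of the free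
product. -/
lemma commutes (H : IsFreeProduct i j) {M N : Type*} [AddCommGroup M] [Module k M]
    [AddCommGroup N] [Module k N] (ρ : S →ₐ[k] Module.End k M) (σ : S →ₐ[k] Module.End k N)
    (f : M →ₗ[k] N) (hi : ∀ a, f ∘ₗ ρ (i a) = σ (i a) ∘ₗ f)
    (hj : ∀ b, f ∘ₗ ρ (j b) = σ (j b) ∘ₗ f) (s : S) : f ∘ₗ ρ s = σ s ∘ₗ f := by
  let T : Subalgebra k S :=
    { carrier := {s | f ∘ₗ ρ s = σ s ∘ₗ f}
      mul_mem' := fun {x y} hx hy => by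
        simp only [Set.mem_ofPred_eq, map_mul, Module.End.mul_eq_comp] at *
        rw [← LinearMap.comp_assoc, hx, LinearMap.comp_assoc, hy, LinearMap.comp_assoc]
      add_mem' := fun {x y} hx hy => by
        simp only [Set.mem_ofPred_eq, map_add, LinearMap.comp_add, LinearMap.add_comp] at *
        rw [hx, hy]
      algebraMap_mem' := fun r => by
        ext m
        simp [AlgHom.commutes, Module.algebraMap_end_apply] }
  have hT : T = ⊤ := H.eq_top T hi hj
  have : s ∈ T := hT ▸ Algebra.mem_top
  exact this

/-- A linear map between modules over the free product is linear if it is linear over the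
factors. -/
lemma map_smul_of (H : IsFreeProduct i j) {M N : Type*} [AddCommGroup M] [Module k M]
    [Module S M] [IsScalarTower k S M] [AddCommGroup N] [Module k N] [Module S N]
    [IsScalarTower k S N] (f : M →ₗ[k] N) (hi : ∀ a m, f (i a • m) = i a • f m)
    (hj : ∀ b m, f (j b • m) = j b • f m) (s : S) (m : M) : f (s • m) = s • f m :=
  LinearMap.congr_fun (H.commutes (Algebra.lsmul k k M) (Algebra.lsmul k k N) f
    (fun a => LinearMap.ext (hi a)) (fun b => LinearMap.ext (hj b)) s) m

/-- An equivariant surjection from a vector space with actions of both factors onto a projective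
module over the free product splits equivariantly. -/
lemma exists_section (H : IsFreeProduct i j) {G P : Type u} [AddCommGroup G] [Module k G]
    [AddCommGroup P] [Module k P] [Module S P] [IsScalarTower k S P] [Module.Projective S P]
    (ρ : A →ₐ[k] Module.End k G) (σ : B →ₐ[k] Module.End k G) (π : G →ₗ[k] P)
    (hπ : Function.Surjective π) (hρ : ∀ a g, π (ρ a g) = i a • π g)
    (hσ : ∀ b g, π (σ b g) = j b • π g) :
    ∃ s : P →ₗ[k] G, (∀ p, π (s p) = p) ∧ (∀ a p, s (i a • p) = ρ a (s p)) ∧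
      ∀ b p, s (j b • p) = σ b (s p) := by
  -- No compatibility between `ρ` and `σ` is required: any two actions on `G` extend to one action
  -- of `S`.
  obtain ⟨τ, ⟨rfl, rfl⟩, -⟩ := H _ ρ σ
  let : Module S G := Module.compHom G τ.toRingHom
  have hτ : ∀ s (g : G), s • g = τ s g := fun _ _ => rfl
  have : IsScalarTower k S G := IsScalarTower.of_algebraMap_smul fun r g => by
    rw [hτ, AlgHom.commutes, Module.algebraMap_end_apply]
  let π' : G →ₗ[S] P :=
    { toFun := π
      map_add' := map_add π
      map_smul' := H.map_smul_of π hρ hσ }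
  obtain ⟨s, hs⟩ := Module.projective_lifting_property π' LinearMap.id hπ
  exact ⟨s.restrictScalars k, fun p => LinearMap.congr_fun hs p, fun a p => s.map_smul _ _,
    fun b p => s.map_smul _ _⟩

/-- Every linear map out of a projective module over the free product is the sum of maps linear
over the two factors. -/
lemma exists_eq_add (H : IsFreeProduct i j) {P N : Type u} [AddCommGroup P] [Module k P]
    [Module S P] [IsScalarTower k S P] [Module.Projective S P] [AddCommGroup N] [Module k N]
    [Module S N] [IsScalarTower k S N] (h : P →ₗ[k] N) :
    ∃ h₁ h₂ : P →ₗ[k] N, h = h₁ + h₂ ∧ (∀ a p, h₁ (i a • p) = i a • h₁ p) ∧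
      ∀ b p, h₂ (j b • p) = j b • h₂ p := by
  -- `c` is the shear `(n, p) ↦ (n + h p, p)`. Let `A` act diagonally on `N × P` and `B` by the
  -- diagonal action conjugated by `c`. An equivariant section of the projection to `P` has the form
  -- `p ↦ (h₁ p, p)`, with `h₁` linear over `A` and `h₁ - h` linear over `B`.
  let c : (N × P) ≃ₗ[k] (N × P) := LinearEquiv.ofLinearMap
    ((LinearMap.fst k N P + h ∘ₗ LinearMap.snd k N P).prod (LinearMap.snd k N P))
    ((LinearMap.fst k N P - h ∘ₗ LinearMap.snd k N P).prod (LinearMap.snd k N P))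
    (by ext <;> simp) (by ext <;> simp)
  let δ : S →ₐ[k] Module.End k (N × P) := Algebra.lsmul k k (N × P)
  obtain ⟨s, hs, hsi, hsj⟩ := H.exists_section (δ.comp i)
    ((c.conjAlgEquiv k).toAlgHom.comp (δ.comp j)) (LinearMap.snd k N P)
    (fun p => ⟨(0, p), rfl⟩) (fun a g => rfl) (fun b g => rfl)
  have hs' : ∀ p, (s p).2 = p := hs
  refine ⟨LinearMap.fst k N P ∘ₗ s, h - LinearMap.fst k N P ∘ₗ s, by abel, ?_, ?_⟩
  · intro a p
    exact congrArg Prod.fst (hsi a p)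
  · intro b p
    have h1 : (s (j b • p)).1 = j b • ((s p).1 - h (s p).2) + h (j b • (s p).2) :=
      congrArg Prod.fst (hsj b p)
    simp only [LinearMap.sub_apply, LinearMap.comp_apply, LinearMap.fst_apply, h1, hs', smul_sub]
    abel

/-! ### Projectivity over the factors -/

/-- A surjection of vector spaces whose kernel has prescribed infinite dimension, the largest
possible, is a projection from a product. -/
lemma exists_equiv_prod_finsupp {k F P J : Type u} [Field k] [AddCommGroup F] [Module k F]
    [AddCommGroup P] [Module k P] (π : F →ₗ[k] P) (hπ : Function.Surjective π)
    (hF : Cardinal.mk F ≤ Cardinal.mk J) (t : (J →₀ k) →ₗ[k] F) (ht : Function.Injective t)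
    (hπt : ∀ x, π (t x) = 0) :
    ∃ e : F ≃ₗ[k] (P × (J →₀ k)), ∀ x, (e x).1 = π x := by
  -- The kernel has at most `|F| ≤ |J|` elements and contains a copy of `J →₀ k` through `t`.
  have hr : Module.rank k (LinearMap.ker π) = Cardinal.mk J := by
    apply le_antisymm
    · exact (rank_le_card k _).trans ((Cardinal.mk_le_of_injective Subtype.val_injective).trans hF)
    · have ht' : Function.Injective (t.codRestrict (LinearMap.ker π) hπt) :=
        fun x y hxy => ht (congrArg Subtype.val hxy)
      simpa using LinearMap.rank_le_of_injective _ ht'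
  obtain ⟨e₀⟩ : Nonempty (LinearMap.ker π ≃ₗ[k] (J →₀ k)) :=
    nonempty_linearEquiv_of_rank_eq (by simpa using hr)
  obtain ⟨σ, hσ⟩ := π.exists_rightInverse_of_surjective (LinearMap.range_eq_top.2 hπ)
  have hσ' : ∀ p, π (σ p) = p := fun p => LinearMap.congr_fun hσ p
  let q : F →ₗ[k] LinearMap.ker π :=
    (LinearMap.id - σ ∘ₗ π).codRestrict _ (fun x => by simp [hσ'])
  refine ⟨LinearEquiv.ofBijective (π.prod (e₀.toLinearMap ∘ₗ q)) ⟨?_, ?_⟩, fun x => rfl⟩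
  · rw [injective_iff_map_eq_zero]
    intro x hx
    obtain ⟨h1, h2⟩ := Prod.mk.inj hx
    have h3 : x - σ (π x) = 0 := congrArg Subtype.val (e₀.map_eq_zero_iff.1 h2)
    simpa [show π x = 0 from h1] using h3
  · rintro ⟨p, y⟩
    have h0 : π (e₀.symm y) = 0 := (e₀.symm y).2
    refine ⟨σ p + e₀.symm y, Prod.ext ?_ ?_⟩
    · change π (σ p + e₀.symm y) = p
      rw [map_add, hσ', h0, add_zero]
    · change e₀ (q (σ p + e₀.symm y)) = y
      rw [← LinearEquiv.eq_symm_apply]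
      refine Subtype.ext ?_
      change σ p + e₀.symm y - σ (π (σ p + e₀.symm y)) = _
      rw [map_add, hσ', h0, add_zero, add_sub_cancel_left]

/-- A module is the quotient of a free module by a subspace of prescribed large dimension. -/
lemma exists_projective_cover_of_card {P J : Type u} [Nontrivial A] [AddCommGroup P] [Module k P]
    [Module A P] [IsScalarTower k A P] [Infinite J] (hA : Cardinal.mk A ≤ Cardinal.mk J)
    (hP : Cardinal.mk P ≤ Cardinal.mk J) :
    ∃ (F : Type u) (_ : AddCommGroup F) (_ : Module k F) (_ : Module A F) (_ : IsScalarTower k A F)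
      (π : F →ₗ[A] P) (e : F ≃ₗ[k] (P × (J →₀ k))), Module.Projective A F ∧
      ∀ x, (e x).1 = π x := by
  -- The generators from `P` make `π` surjective; those from `J` go to zero, which makes the kernel
  -- large.
  let π : ((P ⊕ J) →₀ A) →ₗ[A] P := Finsupp.linearCombination A (Sum.elim id 0)
  have hπ : Function.Surjective π := fun p => ⟨Finsupp.single (Sum.inl p) 1, by simp [π]⟩
  have hF : Cardinal.mk ((P ⊕ J) →₀ A) ≤ Cardinal.mk J := by
    rw [Cardinal.mk_finsupp_of_infinite, Cardinal.mk_sum, Cardinal.lift_id, Cardinal.lift_id]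
    exact max_le ((Cardinal.add_le_max _ _).trans (by simp [hP])) hA
  let t : (J →₀ k) →ₗ[k] ((P ⊕ J) →₀ A) :=
    Finsupp.lmapDomain A k Sum.inr ∘ₗ Finsupp.mapRange.linearMap (Algebra.linearMap k A)
  obtain ⟨e, he⟩ := exists_equiv_prod_finsupp (π.restrictScalars k) hπ hF t
    (fun x y hxy => Finsupp.mapRange_injective _ (map_zero _) (algebraMap k A).injective
      (Finsupp.mapDomain_injective Sum.inr_injective hxy))
    (fun x => by
      change Finsupp.linearCombination A (Sum.elim id 0) (Finsupp.mapDomain Sum.inr _) = 0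
      rw [Finsupp.linearCombination_mapDomain]
      exact Finset.sum_eq_zero fun _ _ => smul_zero _)
  exact ⟨(P ⊕ J) →₀ A, inferInstance, inferInstance, inferInstance, inferInstance, π, e,
    inferInstance, he⟩

/-- Projective modules over the free product are projective over the first factor. -/
lemma projective_left (H : IsFreeProduct i j) [Nontrivial A] [Nontrivial B] {P : Type u}
    [AddCommGroup P] [Module k P] [Module S P] [IsScalarTower k S P] [Module.Projective S P]
    [Module A P] (hA : ∀ (a : A) (p : P), a • p = i a • p) : Module.Projective A P := by
  have : IsScalarTower k A P := IsScalarTower.of_algebraMap_smul fun r p => by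
    rw [hA, AlgHom.commutes, algebraMap_smul]
  let : Module B P := Module.compHom P j.toRingHom
  have hB : ∀ (b : B) (p : P), b • p = j b • p := fun _ _ => rfl
  have : IsScalarTower k B P := IsScalarTower.of_algebraMap_smul fun r p => by
    rw [hB, AlgHom.commutes, algebraMap_smul]
  -- `J` is infinite and at least as large as `A`, `B` and `P`. Using one `J` for both covers makes
  -- them the same vector space `P × (J →₀ k)` over `P`.
  let J : Type u := A ⊕ B ⊕ P ⊕ ℕ
  obtain ⟨F, _, _, _, _, π, e, hF, he⟩ := exists_projective_cover_of_card (A := A) (k := k)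
    (P := P) (J := J) (Cardinal.mk_le_of_injective (f := Sum.inl) Sum.inl_injective)
    (Cardinal.mk_le_of_injective 
      (Sum.inr_injective.comp (Sum.inr_injective.comp Sum.inl_injective)))
  obtain ⟨F', _, _, _, _, π', e', -, he'⟩ := exists_projective_cover_of_card (A := B) (k := k)
    (P := P) (J := J) (Cardinal.mk_le_of_injective (Sum.inr_injective.comp Sum.inl_injective))
    (Cardinal.mk_le_of_injective 
      (Sum.inr_injective.comp (Sum.inr_injective.comp Sum.inl_injective)))
  -- `A` acts on `P × (J →₀ k)` through `F`, and `B` through `F'`. The resulting `S`-module over `P`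
  -- splits, and over `A` this splits the projective cover `F`.
  obtain ⟨s, hs, hsi, -⟩ := H.exists_section
    ((e.conjAlgEquiv k).toAlgHom.comp (Algebra.lsmul k k F))
    ((e'.conjAlgEquiv k).toAlgHom.comp (Algebra.lsmul k k F')) (LinearMap.fst k P (J →₀ k))
    (fun p => ⟨(p, 0), rfl⟩)
    (fun a g => by
      change (e (a • e.symm g)).1 = i a • g.1
      rw [he, map_smul, ← he, e.apply_symm_apply, hA])
    (fun b g => by
      change (e' (b • e'.symm g)).1 = j b • g.1
      rw [he', map_smul, ← he', e'.apply_symm_apply, hB])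
  let s' : P →ₗ[A] F :=
    { toFun := fun p => e.symm (s p)
      map_add' := fun x y => by simp
      map_smul' := fun a p => by
        rw [hA, hsi]
        exact e.symm_apply_apply _ }
  refine Module.Projective.of_split s' π (LinearMap.ext fun p => ?_)
  change π (e.symm (s p)) = p
  rw [← he, e.apply_symm_apply]
  exact hs p

lemma symm (H : IsFreeProduct i j) : IsFreeProduct j i := fun W _ _ f g => by
  simpa only [and_comm] using H W g f

end IsFreeProduct

/-! ### Dimension shifting and exact functors -/

section AbelianCategory

universe w v u'

variable {C : Type u'} [Category.{v} C] [Abelian C] [HasExt.{w} C]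

/-- Dimension shifting along a short exact sequence with projective middle term. -/
lemma exists_extClass_comp_eq {T : ShortComplex C} (hT : T.ShortExact) [Projective T.X₂] {Y : C}
    {n : ℕ} (x : Ext.{w} T.X₃ Y (n + 1)) :
    ∃ x' : Ext.{w} T.X₁ Y n, hT.extClass.comp x' (add_comm 1 n) = x :=
  Ext.contravariant_sequence_exact₃ hT Y x (Ext.eq_zero_of_projective _) (add_comm 1 n)

/-- Dimension shifting is injective in positive degrees. -/
lemma eq_zero_of_extClass_comp_eq_zero {T : ShortComplex C} (hT : T.ShortExact) [Projective T.X₂]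
    {Y : C} {n : ℕ} (x : Ext.{w} T.X₁ Y (n + 1))
    (hx : hT.extClass.comp x (add_comm 1 (n + 1)) = 0) : x = 0 := by
  obtain ⟨y, rfl⟩ := Ext.contravariant_sequence_exact₁ hT Y x (add_comm 1 (n + 1)) hx
  rw [Ext.eq_zero_of_projective y, Ext.comp_zero]

/-- The connecting map kills exactly the morphisms extending to the middle term. -/
lemma extClass_comp_mk₀_eq_zero_iff {T : ShortComplex C} (hT : T.ShortExact) {Y : C}
    (f : T.X₁ ⟶ Y) : hT.extClass.comp (Ext.mk₀ f) (add_zero 1) = (0 : Ext.{w} T.X₃ Y 1) ↔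
      ∃ g : T.X₂ ⟶ Y, T.f ≫ g = f := by
  constructor
  · intro hf
    obtain ⟨y, hy⟩ := Ext.contravariant_sequence_exact₁ hT Y (Ext.mk₀ f) (add_zero 1) hf
    obtain ⟨g, rfl⟩ := (Ext.mk₀_bijective _ _).2 y
    rw [Ext.mk₀_comp_mk₀] at hy
    exact ⟨g, (Ext.mk₀_bijective _ _).1 hy⟩
  · rintro ⟨g, rfl⟩
    rw [← Ext.mk₀_comp_mk₀, hT.extClass_comp_assoc]

lemma extClass_comp_mk₀_add {T : ShortComplex C} (hT : T.ShortExact) {Y : C}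
    (f : T.X₁ ⟶ Y) (g : T.X₂ ⟶ Y) :
    (hT.extClass.comp (Ext.mk₀ (f + T.f ≫ g)) (add_zero 1) : Ext.{w} T.X₃ Y 1) =
      hT.extClass.comp (Ext.mk₀ f) (add_zero 1) := by
  rw [Ext.mk₀_add, Ext.comp_add, (extClass_comp_mk₀_eq_zero_iff hT _).2 ⟨g, rfl⟩, add_zero]

variable {D : Type*} [Category* D] [Abelian D] [HasExt D] (R : C ⥤ D) [R.Additive]
  [Limits.PreservesFiniteLimits R] [Limits.PreservesFiniteColimits R]

lemma mapExactFunctor_extClass_comp {T : ShortComplex C} (hT : T.ShortExact) {Y : C} {n m : ℕ}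
    (x : Ext.{w} T.X₁ Y n) (h : 1 + n = m) :
    (hT.extClass.comp x h).mapExactFunctor R =
      (hT.map_of_exact R).extClass.comp (x.mapExactFunctor R) h := by
  rw [Ext.mapExactFunctor_comp, Ext.mapExactFunctor_extClass]
  rfl

/-- A morphism extending to the middle term contributes nothing to the class. Here `g` need only
exist in the target category, as happens for maps linear over one factor. -/
lemma mapExactFunctor_extClass_comp_mk₀ {T : ShortComplex C} (hT : T.ShortExact) {Y : C}
    (f : T.X₁ ⟶ Y) (g : R.obj T.X₂ ⟶ R.obj Y) :
    (hT.extClass.comp (Ext.mk₀ f) (add_zero 1)).mapExactFunctor R =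
      (hT.map_of_exact R).extClass.comp (Y := R.obj T.X₁)
        (Ext.mk₀ (R.map f + R.map T.f ≫ g)) (add_zero 1) := by
  rw [mapExactFunctor_extClass_comp, Ext.mapExactFunctor_mk₀]
  exact (extClass_comp_mk₀_add (hT.map_of_exact R) (R.map f) g).symm

end AbelianCategory

lemma exists_projective_presentation {S : Type u} [Ring S] (M : ModuleCat.{u} S) :
    ∃ T : ShortComplex (ModuleCat.{u} S), T.ShortExact ∧ Projective T.X₂ ∧ T.X₃ = M :=
  ⟨M.projectiveShortComplex, M.shortExact_projectiveShortComplex,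
    ModuleCat.projective_of_categoryTheory_projective _, rfl⟩

open scoped ModuleCat

/-! ### Morphisms of restricted modules as linear maps -/

section RestrictScalars

variable {k A S : Type u} [Field k] [Ring A] [Ring S] [Algebra k A] [Algebra k S]
  (i : A →ₐ[k] S) {X Y : ModuleCat.{u} S}

/-- A morphism between restrictions of modules along an algebra homomorphism, as a linear map over
the ground field. -/
noncomputable def restrictHomToLinear (f : (ModuleCat.restrictScalars i.toRingHom).obj X ⟶
    (ModuleCat.restrictScalars i.toRingHom).obj Y) : X →ₗ[k] Y where
  toFun := f.hom
  map_add' := f.hom.map_add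
  map_smul' r x := by
    have h := f.hom.map_smul (algebraMap k A r) x
    change f.hom (i (algebraMap k A r) • x) = i (algebraMap k A r) • (f.hom x : Y) at h
    rw [AlgHom.commutes] at h
    exact h

lemma restrictHomToLinear_smul (f : (ModuleCat.restrictScalars i.toRingHom).obj X ⟶
    (ModuleCat.restrictScalars i.toRingHom).obj Y) (a : A) (x : X) :
    restrictHomToLinear i f (i a • x) = i a • restrictHomToLinear i f x :=
  f.hom.map_smul a x

/-- A linear map compatible with the action of `A`, as a morphism between restrictions. -/
noncomputable def linearToRestrictHom (f : X →ₗ[k] Y) (hf : ∀ a x, f (i a • x) = i a • f x) :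
    (ModuleCat.restrictScalars i.toRingHom).obj X ⟶
      (ModuleCat.restrictScalars i.toRingHom).obj Y :=
  ModuleCat.ofHom (X := (ModuleCat.restrictScalars i.toRingHom).obj X)
    (Y := (ModuleCat.restrictScalars i.toRingHom).obj Y)
    { toFun := f
      map_add' := f.map_add
      map_smul' := hf }

end RestrictScalars

/-! ### Gluing morphisms over the two factors -/

namespace IsFreeProduct

variable {k A B S : Type u} [Field k] [Ring A] [Ring B] [Ring S] [Algebra k A]
    [Algebra k B] [Algebra k S] {i : A →ₐ[k] S} {j : B →ₐ[k] S}

/-- Restriction to the first factor preserves projective modules. -/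
lemma projective_restrictScalars (H : IsFreeProduct i j) [Nontrivial A] [Nontrivial B]
    (P : ModuleCat.{u} S) [Projective P] :
    Projective ((ModuleCat.restrictScalars i.toRingHom).obj P) := by
  have : Module.Projective S P := inferInstance
  have : Module.Projective A ((ModuleCat.restrictScalars i.toRingHom).obj P) :=
    @projective_left k A B S _ _ _ _ _ _ _ i j H _ _ P _ _ _ _ _
      ((ModuleCat.restrictScalars i.toRingHom).obj P).isModule (fun _ _ => rfl)
  exact ModuleCat.projective_of_categoryTheory_projective _

variable (i j) in
/-- Every linear map is a sum of maps linear over the two factors. -/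
def Decomposable (M N : ModuleCat.{u} S) : Prop :=
  ∀ h : M →ₗ[k] N, ∃ h₁ h₂ : M →ₗ[k] N, h = h₁ + h₂ ∧ (∀ a p, h₁ (i a • p) = i a • h₁ p) ∧
      ∀ b p, h₂ (j b • p) = j b • h₂ p

lemma decomposable_of_projective (H : IsFreeProduct i j) (P N : ModuleCat.{u} S) [Projective P] :
    Decomposable i j P N := fun h => by
  have : Module.Projective S P := inferInstance
  exact H.exists_eq_add h

/-- Linear maps over a field extend from a subspace. Hence syzygies, being submodules of
projectives, are decomposable. -/
lemma Decomposable.of_injective {K F N : ModuleCat.{u} S} (hF : Decomposable i j F N) (f : K ⟶ F)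
    (hf : Function.Injective f.hom) : Decomposable i j K N := fun h => by
  let f' : K →ₗ[k] F := f.hom.restrictScalars k
  obtain ⟨g, hg⟩ := f'.exists_leftInverse_of_injective (LinearMap.ker_eq_bot.2 hf)
  obtain ⟨h₁, h₂, e, h3, h4⟩ := hF (h ∘ₗ g)
  have hf' : ∀ (s : S) (x : K), f' (s • x) = s • f' x := f.hom.map_smul
  refine ⟨h₁ ∘ₗ f', h₂ ∘ₗ f', ?_, fun a p => ?_, fun b p => ?_⟩
  · rw [← LinearMap.add_comp, ← e, LinearMap.comp_assoc, hg, LinearMap.comp_id]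
  · rw [LinearMap.comp_apply, hf', h3]; rfl
  · rw [LinearMap.comp_apply, hf', h4]; rfl

variable {T : ShortComplex (ModuleCat.{u} S)} {N : ModuleCat.{u} S}

/-- Morphisms over the two factors from a submodule of a decomposable module differ from one
morphism over the free product by extendable morphisms. -/
lemma exists_hom_sub (H : IsFreeProduct i j) (hT : T.ShortExact) (hF : Decomposable i j T.X₂ N)
    (f₁ : (ModuleCat.restrictScalars i.toRingHom).obj T.X₁ ⟶
      (ModuleCat.restrictScalars i.toRingHom).obj N)
    (f₂ : (ModuleCat.restrictScalars j.toRingHom).obj T.X₁ ⟶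
      (ModuleCat.restrictScalars j.toRingHom).obj N) :
    ∃ (f : T.X₁ ⟶ N) (h₁ : (ModuleCat.restrictScalars i.toRingHom).obj T.X₂ ⟶
      (ModuleCat.restrictScalars i.toRingHom).obj N)
      (h₂ : (ModuleCat.restrictScalars j.toRingHom).obj T.X₂ ⟶
      (ModuleCat.restrictScalars j.toRingHom).obj N),
      f₁ = (ModuleCat.restrictScalars i.toRingHom).map f +
        (ModuleCat.restrictScalars i.toRingHom).map T.f ≫ h₁ ∧
      f₂ = (ModuleCat.restrictScalars j.toRingHom).map f +
        (ModuleCat.restrictScalars j.toRingHom).map T.f ≫ h₂ := by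
  let ι : T.X₁ →ₗ[k] T.X₂ := T.f.hom.restrictScalars k
  have hι : ∀ (s : S) (x : T.X₁), ι (s • x) = s • ι x := T.f.hom.map_smul
  obtain ⟨r, hr⟩ := ι.exists_leftInverse_of_injective
    (LinearMap.ker_eq_bot.2 hT.moduleCat_injective_f)
  let g₁ := restrictHomToLinear i f₁
  let g₂ := restrictHomToLinear j f₂
  -- Extend `g₁ - g₂` to `T.X₂` and decompose it. On `T.X₁` this reads `g₁ - h₁ = g₂ + h₂`: the left
  -- side is linear over `A`, the right side over `B`, so the common value is linear over `S`.
  obtain ⟨h₁, h₂, e, h3, h4⟩ := hF ((g₁ - g₂) ∘ₗ r)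
  have e' : ∀ x, g₁ x - h₁ (ι x) = g₂ x + h₂ (ι x) := fun x => by
    have := LinearMap.congr_fun e (ι x)
    have hrx : r (ι x) = x := LinearMap.congr_fun hr x
    simp only [LinearMap.comp_apply, LinearMap.add_apply, LinearMap.sub_apply, hrx] at this
    rw [sub_eq_iff_eq_add] at this ⊢
    rw [this]; abel
  let f : T.X₁ →ₗ[k] N := g₁ - h₁ ∘ₗ ι
  have hf₂ : ∀ x, f x = g₂ x + h₂ (ι x) := e'
  have hf := H.map_smul_of f
    (fun a x => by
      change g₁ (i a • x) - h₁ (ι (i a • x)) = i a • (g₁ x - h₁ (ι x))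
      rw [hι, h3, restrictHomToLinear_smul, smul_sub])
    (fun b x => by
      rw [hf₂, hf₂, hι, h4, restrictHomToLinear_smul, smul_add])
  refine ⟨ModuleCat.ofHom { toFun := f, map_add' := f.map_add, map_smul' := hf },
    linearToRestrictHom i h₁ h3,
    linearToRestrictHom j (-h₂) (fun b x => by simp [h4]), ?_, ?_⟩
  · ext x
    exact (sub_add_cancel (g₁ x) (h₁ (ι x))).symm
  · ext x
    exact eq_add_neg_of_add_eq (hf₂ x).symm

/-- A morphism extending over both factors extends over the free product, if linear maps out of the
cokernel decompose. -/
lemma exists_extension (H : IsFreeProduct i j) (hT : T.ShortExact) (hM : Decomposable i j T.X₃ N)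
    (f : T.X₁ ⟶ N)
    (f₁ : (ModuleCat.restrictScalars i.toRingHom).obj T.X₂ ⟶
      (ModuleCat.restrictScalars i.toRingHom).obj N)
    (f₂ : (ModuleCat.restrictScalars j.toRingHom).obj T.X₂ ⟶
      (ModuleCat.restrictScalars j.toRingHom).obj N)
    (hf₁ : (ModuleCat.restrictScalars i.toRingHom).map T.f ≫ f₁ =
      (ModuleCat.restrictScalars i.toRingHom).map f)
    (hf₂ : (ModuleCat.restrictScalars j.toRingHom).map T.f ≫ f₂ =
      (ModuleCat.restrictScalars j.toRingHom).map f) :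
    ∃ g : T.X₂ ⟶ N, T.f ≫ g = f := by
  let π : T.X₂ →ₗ[k] T.X₃ := T.g.hom.restrictScalars k
  have hπ : ∀ (s : S) (x : T.X₂), π (s • x) = s • π x := T.g.hom.map_smul
  obtain ⟨σ, hσ⟩ := π.exists_rightInverse_of_surjective
    (LinearMap.range_eq_top.2 hT.moduleCat_surjective_g)
  let g₁ := restrictHomToLinear i f₁
  let g₂ := restrictHomToLinear j f₂
  have e₁ : ∀ x : T.X₁, g₁ (T.f.hom x) = f.hom x := fun x =>
    LinearMap.congr_fun (congrArg ModuleCat.Hom.hom hf₁) x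
  have e₂ : ∀ x : T.X₁, g₂ (T.f.hom x) = f.hom x := fun x =>
    LinearMap.congr_fun (congrArg ModuleCat.Hom.hom hf₂) x
  have hex := (ShortComplex.ShortExact.moduleCat_exact_iff_function_exact T).1 hT.exact
  have hπι : ∀ x : T.X₁, π (T.f.hom x) = 0 := fun x => (hex _).2 ⟨x, rfl⟩
  -- Both extensions agree with `f` on `T.X₁`, so `g₁ - g₂` factors through `π` as `(g₁ - g₂) ∘ σ`.
  -- Decomposing this map on `T.X₃` corrects `g₁` and `g₂` to one map without changing them on
  -- `T.X₁`.
  obtain ⟨h₁, h₂, e, h3, h4⟩ := hM ((g₁ - g₂) ∘ₗ σ)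
  have e' : ∀ x, g₁ x - h₁ (π x) = g₂ x + h₂ (π x) := fun x => by
    have h5 := LinearMap.congr_fun e (π x)
    have h6 : π (x - σ (π x)) = 0 := by
      rw [map_sub, show π (σ (π x)) = π x from LinearMap.congr_fun hσ _, sub_self]
    obtain ⟨y, hy⟩ := (hex _).1 h6
    have h7 : g₁ (x - σ (π x)) = g₂ (x - σ (π x)) := by
      have := (e₁ y).trans (e₂ y).symm
      rwa [hy] at this
    simp only [LinearMap.comp_apply, LinearMap.add_apply, LinearMap.sub_apply] at h5
    rw [map_sub, map_sub, sub_eq_sub_iff_sub_eq_sub, h5] at h7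
    rw [sub_eq_iff_eq_add] at h7 ⊢
    rw [h7]; abel
  let f' : T.X₂ →ₗ[k] N := g₁ - h₁ ∘ₗ π
  have hf₂ : ∀ x, f' x = g₂ x + h₂ (π x) := e'
  have hf := H.map_smul_of f'
    (fun a x => by
      change g₁ (i a • x) - h₁ (π (i a • x)) = i a • (g₁ x - h₁ (π x))
      rw [hπ, h3, restrictHomToLinear_smul, smul_sub])
    (fun b x => by
      rw [hf₂, hf₂, hπ, h4, restrictHomToLinear_smul, smul_add])
  refine ⟨ModuleCat.ofHom { toFun := f', map_add' := f'.map_add, map_smul' := hf }, ?_⟩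
  ext x
  change g₁ (T.f.hom x) - h₁ (π (T.f.hom x)) = _
  rw [hπι, map_zero, sub_zero, e₁]

/-! ### Restriction of Ext to the factors in positive degrees -/

variable [Nontrivial A] [Nontrivial B]

/-- In positive degrees, pairs of extension classes over the two factors lift to the free
product. -/
theorem exists_mapExactFunctor_eq (H : IsFreeProduct i j) (n : ℕ) (M N : ModuleCat.{u} S)
    (a : Ext.{u} ((ModuleCat.restrictScalars i.toRingHom).obj M)
      ((ModuleCat.restrictScalars i.toRingHom).obj N) (n + 1))
    (b : Ext.{u} ((ModuleCat.restrictScalars j.toRingHom).obj M)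
      ((ModuleCat.restrictScalars j.toRingHom).obj N) (n + 1)) :
    ∃ x : Ext.{u} M N (n + 1),
      x.mapExactFunctor (ModuleCat.restrictScalars i.toRingHom) = a ∧
      x.mapExactFunctor (ModuleCat.restrictScalars j.toRingHom) = b := by
  induction n generalizing M N with
  | zero =>
    obtain ⟨T, hT, _, rfl⟩ := exists_projective_presentation M
    have : Projective (T.map (ModuleCat.restrictScalars i.toRingHom)).X₂ :=
      H.projective_restrictScalars _
    have : Projective (T.map (ModuleCat.restrictScalars j.toRingHom)).X₂ :=
      H.symm.projective_restrictScalars _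
    obtain ⟨a', rfl⟩ := exists_extClass_comp_eq
      (hT.map_of_exact (ModuleCat.restrictScalars i.toRingHom)) a
    obtain ⟨b', rfl⟩ := exists_extClass_comp_eq
      (hT.map_of_exact (ModuleCat.restrictScalars j.toRingHom)) b
    obtain ⟨f₁, rfl⟩ := (Ext.mk₀_bijective _ _).2 a'
    obtain ⟨f₂, rfl⟩ := (Ext.mk₀_bijective _ _).2 b'
    -- In degree 1 the classes come from morphisms on the syzygy, which may be altered by morphisms
    -- extending to `T.X₂`.
    obtain ⟨f, h₁, h₂, rfl, rfl⟩ := H.exists_hom_sub hT (H.decomposable_of_projective _ N) f₁ f₂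
    exact ⟨hT.extClass.comp (Ext.mk₀ f) (add_zero 1),
      mapExactFunctor_extClass_comp_mk₀ _ hT f h₁, mapExactFunctor_extClass_comp_mk₀ _ hT f h₂⟩
  | succ n ih =>
    obtain ⟨T, hT, _, rfl⟩ := exists_projective_presentation M
    have : Projective (T.map (ModuleCat.restrictScalars i.toRingHom)).X₂ :=
      H.projective_restrictScalars _
    have : Projective (T.map (ModuleCat.restrictScalars j.toRingHom)).X₂ :=
      H.symm.projective_restrictScalars _
    obtain ⟨a', rfl⟩ := exists_extClass_comp_eq
      (hT.map_of_exact (ModuleCat.restrictScalars i.toRingHom)) a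
    obtain ⟨b', rfl⟩ := exists_extClass_comp_eq
      (hT.map_of_exact (ModuleCat.restrictScalars j.toRingHom)) b
    obtain ⟨x, rfl, rfl⟩ := ih _ _ a' b'
    exact ⟨hT.extClass.comp x (add_comm 1 _), mapExactFunctor_extClass_comp _ _ _ _,
      mapExactFunctor_extClass_comp _ _ _ _⟩

/-- In positive degrees, an extension class of a decomposable module that vanishes over both factors
is zero. -/
theorem eq_zero_of_mapExactFunctor_eq_zero (H : IsFreeProduct i j) (n : ℕ) (M N : ModuleCat.{u} S)
    (hM : Decomposable i j M N) (x : Ext.{u} M N (n + 1))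
    (ha : x.mapExactFunctor (ModuleCat.restrictScalars i.toRingHom) = 0)
    (hb : x.mapExactFunctor (ModuleCat.restrictScalars j.toRingHom) = 0) : x = 0 := by
  induction n generalizing M N with
  | zero =>
    obtain ⟨T, hT, _, rfl⟩ := exists_projective_presentation M
    obtain ⟨x, rfl⟩ := exists_extClass_comp_eq hT x
    rw [mapExactFunctor_extClass_comp] at ha hb
    obtain ⟨f, rfl⟩ := (Ext.mk₀_bijective _ _).2 x
    rw [Ext.mapExactFunctor_mk₀] at ha hb
    obtain ⟨f₁, h₁⟩ := (extClass_comp_mk₀_eq_zero_iff (hT.map_of_exact _) _).1 ha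
    obtain ⟨f₂, h₂⟩ := (extClass_comp_mk₀_eq_zero_iff (hT.map_of_exact _) _).1 hb
    exact (extClass_comp_mk₀_eq_zero_iff hT _).2 (H.exists_extension hT hM f f₁ f₂ h₁ h₂)
  | succ n ih =>
    obtain ⟨T, hT, _, rfl⟩ := exists_projective_presentation M
    obtain ⟨x, rfl⟩ := exists_extClass_comp_eq hT x
    rw [mapExactFunctor_extClass_comp] at ha hb
    have : Projective (T.map (ModuleCat.restrictScalars i.toRingHom)).X₂ :=
      H.projective_restrictScalars _
    have : Projective (T.map (ModuleCat.restrictScalars j.toRingHom)).X₂ :=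
      H.symm.projective_restrictScalars _
    have ha' := eq_zero_of_extClass_comp_eq_zero (hT.map_of_exact _) _ ha
    have hb' := eq_zero_of_extClass_comp_eq_zero (hT.map_of_exact _) _ hb
    -- The syzygy embeds in the projective `T.X₂`, so decomposability is available again one degree
    -- lower.
    rw [ih _ _ ((H.decomposable_of_projective _ N).of_injective T.f hT.moduleCat_injective_f) x
      ha' hb', Ext.comp_zero]

end IsFreeProduct

/-! ### The Ext-algebras of augmented algebras -/

namespace AugAlg

variable {k : Type u} [Field k]

lemma nontrivial (A : AugAlg k) : Nontrivial A :=
  A.aug.toRingHom.domain_nontrivial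

lemma isFreeProduct_coprod (Λ Γ : AugAlg k) :
    IsFreeProduct (coprodInl Λ Γ).toAlgHom (coprodInr Λ Γ).toAlgHom := by
  intro W _ _ f g
  let m : (i : Bool) → pair Λ Γ i →ₐ[k] W := fun i => match i with
    | false => f
    | true => g
  let F := LinearAlgebra.FreeProduct.lift k (fun i => (pair Λ Γ i : Type u)) (fun {i} => m i)
  refine ⟨F, ⟨LinearAlgebra.FreeProduct.lift_comp_ι (i := false) k
    (fun i => (pair Λ Γ i : Type u)) (fun {i} => m i),
    LinearAlgebra.FreeProduct.lift_comp_ι (i := true) k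
    (fun i => (pair Λ Γ i : Type u)) (fun {i} => m i)⟩, ?_⟩
  rintro h ⟨rfl, rfl⟩
  refine LinearAlgebra.FreeProduct.lift_unique k (fun i => (pair Λ Γ i : Type u))
    (fun {i} => m i) h (fun i => ?_)
  cases i <;> rfl

-- Elements of the algebras act on the trivial module as scalars of `k`, so `h = h + 0` is already a
-- decomposition.
open scoped ModuleCat in
lemma decomposable_triv {A B C : AugAlg k} (f : Hom A C) (g : Hom B C) :
    IsFreeProduct.Decomposable f.toAlgHom g.toAlgHom (triv C) (triv C) := by
  intro h
  have hs : ∀ (s : C) (x : triv C), s • x = (C.aug s) • x := fun s x => by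
    change (C.aug s) * (show k from x) = C.aug (algebraMap k C (C.aug s)) * (show k from x)
    rw [AlgHom.commutes]; rfl
  refine ⟨h, 0, (add_zero h).symm, fun a p => ?_, fun b p => ?_⟩
  · rw [hs, hs, h.map_smul]
  · simp

lemma mk₀_conj_eq_iff {C : Type*} [Category* C] [Abelian C] [HasExt C] {X Y : C} (e : X ≅ Y)
    {n : ℕ} (z : Ext Y Y n) (y : Ext X X n) :
    (Ext.mk₀ e.hom).comp (z.comp (Ext.mk₀ e.inv) (add_zero n)) (zero_add n) = y ↔
      z = (Ext.mk₀ e.inv).comp (y.comp (Ext.mk₀ e.hom) (add_zero n)) (zero_add n) := by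
  constructor
  · rintro rfl
    simp
  · rintro rfl
    simp

lemma extMapDeg_eq_iff {A B : AugAlg k} (f : Hom A B) (n : ℕ) (x : ExtDeg B n) (y : ExtDeg A n) :
    extMapDeg f n x = y ↔ x.mapExactFunctor (ModuleCat.restrictScalars f.toAlgHom.toRingHom) =
      (Ext.mk₀ (trivIso f).inv).comp (y.comp (Ext.mk₀ (trivIso f).hom) (add_zero n))
        (zero_add n) :=
  mk₀_conj_eq_iff (trivIso f) _ y

lemma extAugDeg_zero_bijective (A : AugAlg k) : Function.Bijective (extAugDeg A 0) := by
  have h : Function.Bijective (evalOne A) := by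
    have hs : ∀ x : k, (show triv A from x) = algebraMap k A x • (show triv A from (1 : k)) :=
      fun x => by
        change x = A.aug (algebraMap k A x) * 1
        rw [AlgHom.commutes, mul_one]; rfl
    constructor
    · intro φ ψ h
      ext x
      rw [hs x, map_smul, map_smul]
      exact congrArg (fun y : triv A => algebraMap k A x • y) h
    · intro c
      refine ⟨c • 𝟙 _, ?_⟩
      rw [map_smul]
      exact mul_one c
  exact h.comp (Ext.linearEquiv₀ (R := k)).bijective

/-- In degree 0 the augmentations identify all three groups with `k`, and `hab` says that `a` and
`b` are the same scalar. In positive degrees the augmentations vanish and the restriction theorems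
apply, up to conjugation by `trivIso`. -/
lemma existsUnique_extMapDeg_coprod (Λ Γ : AugAlg k) (n : ℕ) (a : ExtDeg Λ n) (b : ExtDeg Γ n)
    (hab : extAugDeg Λ n a = extAugDeg Γ n b) :
    ∃! x : ExtDeg (coprod Λ Γ) n,
      extMapDeg (coprodInl Λ Γ) n x = a ∧ extMapDeg (coprodInr Λ Γ) n x = b := by
  have := Λ.nontrivial
  have := Γ.nontrivial
  have H := isFreeProduct_coprod Λ Γ
  cases n with
  | zero =>
    obtain ⟨x, hx⟩ := (extAugDeg_zero_bijective (coprod Λ Γ)).2 (extAugDeg Λ 0 a)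
    refine ⟨x, ⟨(extAugDeg_zero_bijective Λ).1 ?_, (extAugDeg_zero_bijective Γ).1 ?_⟩, ?_⟩
    · rw [extMapDeg_aug, hx]
    · rw [extMapDeg_aug, hx, hab]
    · rintro y ⟨rfl, -⟩
      exact (extAugDeg_zero_bijective _).1 (by rw [hx, extMapDeg_aug])
  | succ n =>
    obtain ⟨x, hx₁, hx₂⟩ := H.exists_mapExactFunctor_eq n (triv _) (triv _)
      ((Ext.mk₀ (trivIso (coprodInl Λ Γ)).inv).comp
        (a.comp (Ext.mk₀ (trivIso (coprodInl Λ Γ)).hom) (add_zero _)) (zero_add _))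
      ((Ext.mk₀ (trivIso (coprodInr Λ Γ)).inv).comp
        (b.comp (Ext.mk₀ (trivIso (coprodInr Λ Γ)).hom) (add_zero _)) (zero_add _))
    refine ⟨x, ⟨(extMapDeg_eq_iff _ _ _ _).2 hx₁, (extMapDeg_eq_iff _ _ _ _).2 hx₂⟩, ?_⟩
    rintro y ⟨hy₁, hy₂⟩
    rw [extMapDeg_eq_iff] at hy₁ hy₂
    refine sub_eq_zero.1 (H.eq_zero_of_mapExactFunctor_eq_zero n _ _
      (decomposable_triv (coprodInl Λ Γ) (coprodInr Λ Γ)) (y - x) ?_ ?_)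
    · exact (((ModuleCat.restrictScalars _).mapExtAddHom _ _ _).map_sub y x).trans
        (sub_eq_zero.2 (hy₁.trans hx₁.symm))
    · exact (((ModuleCat.restrictScalars _).mapExtAddHom _ _ _).map_sub y x).trans
        (sub_eq_zero.2 (hy₂.trans hx₂.symm))

lemma extMap_apply {A B : AugAlg k} (f : Hom A B) (x : ⨁ n, ExtDeg B n) (n : ℕ) :
    extMap f x n = extMapDeg f n (x n) := by
  classical
  induction x using DirectSum.induction_on with
  | zero => simp
  | of m x =>
    rw [extMap_of]
    by_cases h : m = n
    · subst h; rw [DirectSum.of_eq_same, DirectSum.of_eq_same]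
    · rw [DirectSum.of_eq_of_ne _ _ _ (Ne.symm h), DirectSum.of_eq_of_ne _ _ _ (Ne.symm h),
        map_zero]
  | add x y hx hy => rw [map_add, DirectSum.add_apply, DirectSum.add_apply, map_add, hx, hy]

lemma extAug_apply (A : AugAlg k) (x : ⨁ n, ExtDeg A n) : extAug A x = extAugDeg A 0 (x 0) := by
  classical
  induction x using DirectSum.induction_on with
  | zero => simp
  | of m x =>
    rw [extAug_of]
    cases m with
    | zero => rw [DirectSum.of_eq_same]
    | succ m => rw [DirectSum.of_eq_of_ne _ _ _ (Nat.succ_ne_zero m).symm, map_zero]; rfl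
  | add x y hx hy => rw [map_add, DirectSum.add_apply, map_add, hx, hy]

theorem prodLift_coprod_bijective (Λ Γ : AugAlg k) :
    Function.Bijective (prodLift (E.map (coprodInl Λ Γ)) (E.map (coprodInr Λ Γ))).toAlgHom := by
  classical
  constructor
  · intro (x : ⨁ n, ExtDeg (coprod Λ Γ) n) (y : ⨁ n, ExtDeg (coprod Λ Γ) n) hxy
    have h₁ : extMap (coprodInl Λ Γ) x = extMap (coprodInl Λ Γ) y :=
      congrArg (fun z : prodSubalgebra (E Λ) (E Γ) => (z : E Λ × E Γ).1) hxy
    have h₂ : extMap (coprodInr Λ Γ) x = extMap (coprodInr Λ Γ) y :=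
      congrArg (fun z : prodSubalgebra (E Λ) (E Γ) => (z : E Λ × E Γ).2) hxy
    refine DFinsupp.ext fun n => ?_
    refine (existsUnique_extMapDeg_coprod Λ Γ n (extMapDeg (coprodInl Λ Γ) n (x n))
      (extMapDeg (coprodInr Λ Γ) n (x n)) (by rw [extMapDeg_aug, extMapDeg_aug])).unique
      ⟨rfl, rfl⟩ ⟨?_, ?_⟩
    · exact (extMap_apply _ y n).symm.trans ((congrArg (· n) h₁).symm.trans (extMap_apply _ x n))
    · exact (extMap_apply _ y n).symm.trans ((congrArg (· n) h₂).symm.trans (extMap_apply _ x n))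
  · rintro ⟨⟨a, b⟩, hab⟩
    change ⨁ n, ExtDeg Λ n at a
    change ⨁ n, ExtDeg Γ n at b
    change extAug Λ a = extAug Γ b at hab
    rw [extAug_apply, extAug_apply] at hab
    have hab' : ∀ n, extAugDeg Λ n (a n) = extAugDeg Γ n (b n)
      | 0 => hab
      | _ + 1 => rfl
    choose x hx _ using fun n => existsUnique_extMapDeg_coprod Λ Γ n (a n) (b n) (hab' n)
    let s : Finset ℕ := DFinsupp.support a ∪ DFinsupp.support b
    -- Where `a` and `b` both vanish, uniqueness forces the lift to vanish, so the degreewise lifts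
    -- have finite support.
    have hs : ∀ n ∉ s, x n = 0 := fun n hn => by
      simp only [s, Finset.mem_union, DFinsupp.mem_support_iff, not_or, not_not] at hn
      have h0 := hx n
      rw [hn.1, hn.2] at h0
      exact (existsUnique_extMapDeg_coprod Λ Γ n 0 0 (by rw [map_zero, map_zero])).unique h0
        ⟨map_zero _, map_zero _⟩
    let X : ⨁ n, ExtDeg (coprod Λ Γ) n := DirectSum.mk _ s fun n => x n
    have hX : ∀ n, X n = x n := fun n => by
      by_cases hn : n ∈ s
      · exact DirectSum.mk_apply_of_mem hn
      · rw [hs n hn]; exact DirectSum.mk_apply_of_notMem hn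
    refine ⟨X, Subtype.ext (Prod.ext ?_ ?_)⟩
    · refine DFinsupp.ext fun n => (extMap_apply (coprodInl Λ Γ) X n).trans ?_
      rw [hX, (hx n).1]
    · refine DFinsupp.ext fun n => (extMap_apply (coprodInr Λ Γ) X n).trans ?_
      rw [hX, (hx n).2]

end AugAlg

theorem theorem4p1 {k : Type u} [Field k] (Λ Γ : AugAlg k) :
    ∃ e : AugAlg.E (AugAlg.coprod Λ Γ) ≃ₐ[k] AugAlg.prod (AugAlg.E Λ) (AugAlg.E Γ),
      (AugAlg.prod (AugAlg.E Λ) (AugAlg.E Γ)).aug.comp e.toAlgHom =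
        (AugAlg.E (AugAlg.coprod Λ Γ)).aug ∧
      e.toAlgHom = (AugAlg.prodLift (AugAlg.E.map (AugAlg.coprodInl Λ Γ))
        (AugAlg.E.map (AugAlg.coprodInr Λ Γ))).toAlgHom :=
  ⟨AlgEquiv.ofBijective _ (AugAlg.prodLift_coprod_bijective Λ Γ),
    (AugAlg.prodLift (AugAlg.E.map (AugAlg.coprodInl Λ Γ))
        (AugAlg.E.map (AugAlg.coprodInr Λ Γ))).aug_comp, rfl⟩
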